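/- Let $\widetilde T>0$. An entire function $f$ is said to be of exponential type $\sigma$ if for every $\varepsilon>0$ there is a constant $C$ such that $|f(z)|\le C e^{(\sigma+\varepsilon)|z|}$ for all $z\in\mathbb C$. An entire function $S$ of (finite) exponential type is a sine-type function of type $\sigma$ if its zeros are simple and separated (i.e. $|\lambda-\mu|\ge\delta$ for some $\delta>0$ and all distinct zeros $\lambda,\mu$) and there are positive constants $A,B,H$ such that $$A e^{\sigma|\eta|}\le |S(\xi+i\eta)|\le B e^{\sigma|\eta|}\qquad\text{for } |\eta|\ge H \text{ and all } \xi\in\mathbb R .$$ Let $S$ be a sine-type function of type $\widetilde T/2$ and let $\Lambda=\{\lambda_n\}_{n\in\mathbb Z}$ be its zero set, enumerated without repetition. Let $(c_n)_{n\in\mathbb Z}$ be a bounded sequence of complex numbers. Then the following hold. 1. There exists an entire function $g$ of exponential type $\widetilde T/2$ with $$g(\lambda_n)=c_n\qquad\text{for all } n\in\mathbb Z. \tag{1}$$ 2. The series $$f(z)={\sum_{n\in\mathbb Z}}' c_n\,\frac{S(z)}{S'(\lambda_n)}\left[\frac1{z-\lambda_n}+\frac1{\lambda_n}\right]$$ converges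 absolutely for every $z\in\mathbb C$ and (unconditionally) uniformly on compact subsets of $\mathbb C$. Here the prime means that the summand $1/\lambda_n$ in the brackets is replaced by $0$ if $\lambda_n=0$, and $S(z)/(S'(\lambda_n)(z-\lambda_n))$ is understood as $1$ at its removable singularity $z=\lambda_n$. 3. Every entire function $g$ which satisfies (1) and the growth condition $$|g(\xi+i\eta)|\,e^{-\frac{\widetilde T}{2}|\eta|}=o(|\xi+i\eta|)\qquad\text{as } |\xi+i\eta|\to\infty \tag{2}$$ has the form $g=f+C_s\,S$ with some constant $C_s\in\mathbb C$. 4. Conversely, for every $C_s\in\mathbb C$ the function $g=f+C_s\,S$ is entire, is of exponential type $\widetilde T/2$, and satisfies (1) and (2). -/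

import Mathlib

open Asymptotics Filter Topology

/-- `f` is of exponential type (at most) `σ`: for every `ε > 0` there is a constant `C` with
`|f z| ≤ C * exp ((σ + ε) * |z|)` on the whole plane. -/
def IsOfExpType (f : ℂ → ℂ) (σ : ℝ) : Prop :=
  ∀ ε : ℝ, 0 < ε → ∃ C : ℝ, ∀ z : ℂ, ‖f z‖ ≤ C * Real.exp ((σ + ε) * ‖z‖)

/-- Sine-type functions of type `σ`: entire functions of (some finite) exponential type with simple
and separated zeros and `A * exp (σ * |η|) ≤ |S (ξ + i * η)| ≤ B * exp (σ * |η|)` for `|η| ≥ H`. -/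
structure IsSineType (S : ℂ → ℂ) (σ : ℝ) : Prop where
  entire : Differentiable ℂ S
  expType : ∃ τ : ℝ, IsOfExpType S τ
  simple_zeros : ∀ z : ℂ, S z = 0 → deriv S z ≠ 0
  separated_zeros : ∃ δ : ℝ, 0 < δ ∧ ∀ z w : ℂ, S z = 0 → S w = 0 → z ≠ w → δ ≤ ‖z - w‖
  bounds : ∃ A B H : ℝ, 0 < A ∧ 0 < B ∧ 0 < H ∧ ∀ z : ℂ, H ≤ |z.im| →
    A * Real.exp (σ * |z.im|) ≤ ‖S z‖ ∧ ‖S z‖ ≤ B * Real.exp (σ * |z.im|)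

/-- For a simple zero `a` of `S`: the entire function `S z / (S' a * (z - a))`, with its removable
singularity at `z = a` filled in by its limit `1`. -/
noncomputable def lagrangeKernel (S : ℂ → ℂ) (a z : ℂ) : ℂ :=
  open Classical in if z = a then 1 else S z / (deriv S a * (z - a))

/-- For a simple zero `a` of `S`: the function `S z / S' a * [1 / (z - a) + 1 / a]`, with its
removable singularity at `z = a` filled in; the summand `1 / a` is omitted if `a = 0`. -/
noncomputable def modifiedLagrangeKernel (S : ℂ → ℂ) (a z : ℂ) : ℂ :=
  lagrangeKernel S a z + (open Classical in if a = 0 then 0 else S z / deriv S a * (1 / a))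

/-- `|g (ξ + i * η)| * exp (-σ * |η|) = o(|ξ + i * η|)` as `|ξ + i * η| → ∞`. -/
def HasSublinearGrowth (g : ℂ → ℂ) (σ : ℝ) : Prop :=
  (fun z : ℂ => ‖g z‖ * Real.exp (-(σ * |z.im|))) =o[cocompact ℂ] (fun z : ℂ => ‖z‖)

/-!
The functions `modifiedLagrangeKernel S (lam n)` take the value `1` at `lam n` and `0` at the
other zeros, and `modifiedLagrangeKernel S a z = lagrangeKernel S a z * (z / a)` for `a ≠ 0`.
Everything rests on two-sided estimates of the sine-type function `S`, with `σ = T / 2`.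

* `IsSineType.exists_norm_le`: by the Phragmén-Lindelöf principle in the strip `|Im z| ≤ H`,
  `‖S z‖ ≤ B * exp (σ * |Im z|)` on the whole plane.
* `IsSineType.exists_le_norm_of_zeros_far`: `κ * exp (σ * |Im z|) ≤ ‖S z‖` as long as `z` stays at
  a distance at least `ε` from the zeros. In the strip, `S` is considered on a disc around the
  point above `z` with imaginary part `H`, where `‖S‖` is bounded below. The number of zeros in
  the disc is bounded since they are separated; dividing them out leaves a zero-free function,
  whose logarithm is controlled by the Borel-Carathéodory theorem. The minimum principle then
  bounds `‖S'‖` below at the zeros (`IsSineType.exists_le_norm_deriv`).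

Consequently `‖lagrangeKernel S a z‖ ≤ K * exp (σ * |Im z|) / (1 + ‖z - a‖)`, and the modified
kernel has the additional factor `(1 + ‖z‖) / (1 + ‖a‖)`. As
`(1 + ‖a‖) + (1 + ‖z - a‖) ≥ 1 + ‖z‖`, the elementary inequality `inv_mul_inv_le_rpow` trades half
a power of the larger of these two factors for `(1 + ‖z‖) ^ (-1 / 2)` and leaves the weights
`(1 + ‖a‖) ^ (-3 / 2) + (1 + ‖z - a‖) ^ (-3 / 2)`. Their sum over the zeros is bounded uniformly
in `z`, because the zeros are separated and lie in a strip (`exists_sum_one_add_norm_rpow_le`). So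
the series converges absolutely and locally uniformly, and its sum is
`O(exp (σ * |Im z|) * (1 + ‖z‖) ^ (1 / 2))`, which gives both growth conditions.

For uniqueness, the difference `G` of two interpolants vanishes at the simple zeros of `S`, so
`h = G / S` is entire. The lower bound for `S` gives `h z = o(‖z‖)` off small discs around the
zeros, the maximum principle extends it into the discs, and a Liouville argument shows that `h` is
constant (`apply_eq_apply_of_sublinear_off_discs`, `IsSineType.exists_eq_const_mul`).
-/

/-! ### Lower bounds for functions with few zeros on a disc -/

/-- A bounded zero-free function on a disc is bounded below on a smaller concentric disc, with a
bound that depends only on the radii, the upper bound and the value at the centre: apply the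
Borel-Carathéodory theorem to its logarithm. -/
theorem exists_pos_le_norm_of_ne_zero {r R m M : ℝ} (hr : 0 ≤ r) (hrR : r < R) (hm : 0 < m) :
    ∃ κ : ℝ, 0 < κ ∧ ∀ g : ℂ → ℂ, Differentiable ℂ g → (∀ z ∈ Metric.ball (0 : ℂ) R, g z ≠ 0) →
      (∀ z ∈ Metric.ball (0 : ℂ) R, ‖g z‖ ≤ M) → m ≤ ‖g 0‖ → ∀ z : ℂ, ‖z‖ ≤ r → κ ≤ ‖g z‖ := by
  have hR : 0 < R := hr.trans_lt hrR
  have h0R : (0 : ℂ) ∈ Metric.ball (0 : ℂ) R := Metric.mem_ball_self hR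
  set L : ℝ := |Real.log (M / m)| + 1 with hL
  have hLpos : 0 < L := by positivity
  refine ⟨m * Real.exp (-(2 * L * r / (R - r))), by positivity, fun g hg hne hM hm0 z hz => ?_⟩
  have hMpos : 0 < M := hm.trans_le (hm0.trans (hM 0 h0R))
  have hdiff : DifferentiableOn ℂ (fun z => deriv g z / g z) (Metric.ball 0 R) :=
    (hg.contDiff.differentiable_deriv_two.differentiableOn).div hg.differentiableOn hne
  obtain ⟨F, hF0, hF⟩ := hdiff.isExactOn_ball.with_val_at 0 0
  -- `F` is a branch of `log (g / g 0)`.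
  have hexp : ∀ w ∈ Metric.ball (0 : ℂ) R, g w * Complex.exp (-F w) = g 0 := by
    intro w hw
    have hd : ∀ x ∈ Metric.ball (0 : ℂ) R,
        HasDerivAt (fun z => g z * Complex.exp (-F z)) 0 x := by
      intro x hx
      have h := (hg x).hasDerivAt.mul (hF x hx).neg.cexp
      have h0 : deriv g x * Complex.exp (-F x) + g x * (Complex.exp (-F x) * -(deriv g x / g x))
          = 0 := by
        field_simp [hne x hx]
        ring
      exact h0 ▸ h
    have := Metric.isOpen_ball.is_const_of_deriv_eq_zero
      (convex_ball (0 : ℂ) R).isPreconnected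
      (fun x hx => (hd x hx).differentiableAt.differentiableWithinAt)
      (fun x hx => (hd x hx).deriv) hw h0R
    simpa [hF0] using this
  have hnorm : ∀ w ∈ Metric.ball (0 : ℂ) R, ‖g w‖ = ‖g 0‖ * Real.exp (F w).re := by
    intro w hw
    rw [← hexp w hw, norm_mul, Complex.norm_exp, mul_assoc, ← Real.exp_add]
    simp
  have hre : Set.MapsTo F (Metric.ball 0 R) {z | z.re ≤ L} := by
    intro w hw
    have h1 : m * Real.exp (F w).re ≤ M :=
      (mul_le_mul_of_nonneg_right hm0 (Real.exp_pos _).le).trans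
        ((hnorm w hw).symm.le.trans (hM w hw))
    have h2 : Real.exp (F w).re ≤ M / m := by rw [le_div_iff₀ hm]; linarith
    have h3 := (Real.le_log_iff_exp_le (div_pos hMpos hm)).2 h2
    show (F w).re ≤ L
    linarith [le_abs_self (Real.log (M / m))]
  have hzR : z ∈ Metric.ball (0 : ℂ) R := by simpa using hz.trans_lt hrR
  have hB := Complex.borelCaratheodory hLpos
    (fun x hx => (hF x hx).differentiableAt.differentiableWithinAt) hre hR hzR
  rw [hF0, norm_zero, zero_mul, zero_div, add_zero] at hB
  have hB2 : ‖F z‖ ≤ 2 * L * r / (R - r) := hB.trans (by gcongr)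
  rw [hnorm z hzR]
  have := (abs_le.1 ((Complex.abs_re_le_norm (F z)).trans hB2)).1
  gcongr

theorem dslope_eq_div {f : ℂ → ℂ} {a z : ℂ} (ha : f a = 0) (hz : z ≠ a) :
    dslope f a z = f z / (z - a) := by
  rw [dslope_of_ne _ hz, slope_def_field, ha, sub_zero]

theorem Differentiable.dslope {f : ℂ → ℂ} (hf : Differentiable ℂ f) (a : ℂ) :
    Differentiable ℂ (dslope f a) := by
  have := (Complex.differentiableOn_dslope (f := f) (c := a) univ_mem).2 hf.differentiableOn
  exact differentiableOn_univ.1 this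

/-- The lower bound of `exists_pos_le_norm_of_ne_zero` for functions with `N` simple zeros in the
disc, at the points whose distance to all these zeros is at least `ε`. By induction on `N`,
dividing by one linear factor at a time. The upper bound is needed on a larger disc, so that the
maximum principle applies to the quotient. -/
theorem exists_pos_le_norm_of_card_zeros {r R ε : ℝ} (hr : 0 ≤ r) (hrR : r < R) (hε : 0 < ε)
    (N : ℕ) : ∀ m M : ℝ, 0 < m → ∃ κ : ℝ, 0 < κ ∧ ∀ (f : ℂ → ℂ) (Z : Finset ℂ),
      Differentiable ℂ f → Z.card = N → (∀ z, z ∈ Z ↔ z ∈ Metric.ball (0 : ℂ) R ∧ f z = 0) →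
      (∀ z ∈ Z, deriv f z ≠ 0) → (∀ z ∈ Metric.ball (0 : ℂ) (2 * R), ‖f z‖ ≤ M) → m ≤ ‖f 0‖ →
      ∀ z : ℂ, ‖z‖ ≤ r → (∀ a ∈ Z, ε ≤ ‖z - a‖) → κ ≤ ‖f z‖ := by
  have hR : 0 < R := hr.trans_lt hrR
  induction N with
  | zero =>
    intro m M hm
    obtain ⟨κ, hκ, h⟩ := exists_pos_le_norm_of_ne_zero (M := M) hr hrR hm
    refine ⟨κ, hκ, fun f Z hf hZ hZf _ hM hm0 z hz _ => h f hf (fun w hw h0 => ?_)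
      (fun w hw => hM w (Metric.ball_subset_ball (by linarith) hw)) hm0 z hz⟩
    have := (hZf w).2 ⟨hw, h0⟩
    simp [Finset.card_eq_zero.1 hZ] at this
  | succ N ih =>
    intro m M hm
    -- `f / (z - a)` is at most `M / (R / 2)` in norm, and at least `m / R` at the origin.
    obtain ⟨κ, hκ, h⟩ := ih (m / R) (2 * M / R) (by positivity)
    refine ⟨ε * κ, by positivity, fun f Z hf hZ hZf hd hM hm0 z hz hza => ?_⟩
    obtain ⟨a, ha⟩ : Z.Nonempty := Finset.card_pos.1 (by omega)
    obtain ⟨haR, hfa⟩ := (hZf a).1 ha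
    have haR' : ‖a‖ < R := by simpa using haR
    set g := dslope f a with hg
    have hgd : Differentiable ℂ g := hf.dslope a
    have hga : g a = deriv f a := by simp [hg]
    have hfg : ∀ w, f w = (w - a) * g w := fun w => by
      rw [hg, ← smul_eq_mul, sub_smul_dslope, hfa, sub_zero]
    have hM0 : 0 ≤ M := (norm_nonneg _).trans (hM 0 (Metric.mem_ball_self (by linarith)))
    have key : κ ≤ ‖g z‖ := by
      refine h g (Z.erase a) hgd (by rw [Finset.card_erase_of_mem ha]; omega) (fun w => ?_)
        (fun w hw => ?_) (fun w hw => ?_) ?_ z hz (fun b hb => hza b (Finset.mem_of_mem_erase hb))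
      · rw [Finset.mem_erase, hZf, hfg w]
        constructor
        · rintro ⟨h1, h2, h3⟩
          exact ⟨h2, (mul_eq_zero.1 h3).resolve_left (sub_ne_zero.2 h1)⟩
        · rintro ⟨h2, h3⟩
          refine ⟨?_, h2, by rw [h3, mul_zero]⟩
          rintro rfl
          exact hd w ha (hga ▸ h3)
      · obtain ⟨hwa, hwZ⟩ := Finset.mem_erase.1 hw
        have h0 : g w = 0 := by
          have := ((hZf w).1 hwZ).2
          rw [hfg w] at this
          exact (mul_eq_zero.1 this).resolve_left (sub_ne_zero.2 hwa)
        intro hgw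
        refine hd w hwZ ?_
        have : HasDerivAt (fun w => (w - a) * g w) (1 * g w + (w - a) * deriv g w) w :=
          ((hasDerivAt_id w).sub_const a).mul (hgd w).hasDerivAt
        rw [show f = fun w => (w - a) * g w from funext hfg, this.deriv, h0, hgw]
        simp
      · -- The maximum principle on a ball of radius `ρ < 2 * R` containing `w`, whose boundary is
        -- at distance at least `R / 2` from `a`.
        have hw2 : ‖w‖ < 2 * R := by simpa using hw
        set ρ := max ‖w‖ (3 / 2 * R) with hρ
        have hρ1 : ρ < 2 * R := max_lt hw2 (by linarith)
        have hρ2 : 3 / 2 * R ≤ ρ := le_max_right _ _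
        have hρ0 : ρ ≠ 0 := by linarith
        refine Complex.norm_le_of_forall_mem_frontier_norm_le (U := Metric.ball (0 : ℂ) ρ)
          Metric.isBounded_ball hgd.diffContOnCl (fun v hv => ?_) ?_
        · rw [frontier_ball _ hρ0, mem_sphere_zero_iff_norm] at hv
          have hva : R / 2 ≤ ‖v - a‖ := by
            have := norm_sub_norm_le v a
            linarith
          have hne : v ≠ a := by
            rintro rfl
            simp at hva
            linarith
          rw [hg, dslope_eq_div hfa hne, norm_div]
          calc ‖f v‖ / ‖v - a‖ ≤ M / (R / 2) :=
                div_le_div₀ hM0 (hM v (by simpa [hv] using hρ1)) (by positivity) hva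
            _ = 2 * M / R := by field_simp
        · rw [closure_ball _ hρ0]
          simp [hρ]
      · rw [div_le_iff₀ hR]
        have := hfg 0
        rw [this, norm_mul, zero_sub, norm_neg] at hm0
        nlinarith [norm_nonneg (g 0)]
    rw [hfg z, norm_mul]
    exact mul_le_mul (hza a ha) key hκ.le (norm_nonneg _)

/-! ### Separated points in a strip -/

theorem summable_one_add_abs_int_rpow_neg {p : ℝ} (hp : 1 < p) :
    Summable fun k : ℤ => (1 + |(k : ℝ)|) ^ (-p) := by
  have hN : Summable fun n : ℕ => (1 + (n : ℝ)) ^ (-p) := by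
    have := (summable_nat_add_iff 1).2 (Real.summable_nat_rpow.2 (by linarith : -p < -1))
    refine this.congr fun n => ?_
    push_cast
    rw [add_comm]
  refine Summable.of_nat_of_neg ?_ ?_ <;> simpa using hN

/-- Separated points in a horizontal strip are as sparse as the integers: the sums of
`(1 + ‖z - a‖) ^ (-p)` over such points `a` are bounded uniformly in `z` for `p > 1`. -/
theorem exists_sum_one_add_norm_rpow_le {δ H p : ℝ} (hδ : 0 < δ) (hp : 1 < p) {Z : Set ℂ}
    (hZim : ∀ a ∈ Z, |a.im| ≤ H) (hZ : ∀ a ∈ Z, ∀ b ∈ Z, a ≠ b → δ ≤ ‖a - b‖) :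
    ∃ K : ℝ, ∀ (z : ℂ) (s : Finset ℂ), (∀ a ∈ s, a ∈ Z) →
      ∑ a ∈ s, (1 + ‖z - a‖) ^ (-p) ≤ K := by
  set d := δ / 2 with hd
  have hd0 : 0 < d := by positivity
  set c := min d (1 / 2) with hc
  have hc0 : 0 < c := by positivity
  set I : Finset ℤ := Finset.Icc ⌊-H / d⌋ ⌊H / d⌋
  set h : ℤ × ℤ → ℝ := fun x => c ^ (-p) * ((1 + |(x.1 : ℝ)|) ^ (-p) *
    (I : Set ℤ).indicator (fun _ => 1) x.2) with hh
  have hh0 : ∀ x, 0 ≤ h x := fun x => by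
    have : 0 ≤ (I : Set ℤ).indicator (fun _ => (1 : ℝ)) x.2 :=
      Set.indicator_nonneg (fun _ _ => zero_le_one) _
    positivity
  have hsum : Summable h := by
    refine Summable.mul_left _ ?_
    refine (summable_one_add_abs_int_rpow_neg hp).mul_of_nonneg
      (g := (I : Set ℤ).indicator (fun _ => (1 : ℝ)))
      (summable_of_ne_finset_zero (s := I) fun b hb => by simp [hb]) (fun k => by positivity)
      (Set.indicator_nonneg fun _ _ => zero_le_one)
  refine ⟨∑' x, h x, fun z s hs => ?_⟩
  -- `φ a` is the cell of side `d` that contains `a`, in a grid whose columns are counted from `z`.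
  -- As `|Re| + |Im| < 2 * d = δ` for differences within a cell, it holds at most one point of `Z`.
  set φ : ℂ → ℤ × ℤ := fun a => (⌊(a.re - z.re) / d⌋, ⌊a.im / d⌋) with hφ
  have hinj : Set.InjOn φ s := by
    intro a ha b hb hab
    by_contra hne
    have h1 := hZ a (hs a ha) b (hs b hb) hne
    simp only [hφ, Prod.mk.injEq] at hab
    have hre := Int.abs_sub_lt_one_of_floor_eq_floor hab.1
    have him := Int.abs_sub_lt_one_of_floor_eq_floor hab.2
    rw [← sub_div, abs_div, abs_of_pos hd0, div_lt_one hd0] at hre him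
    have h2 := Complex.norm_le_abs_re_add_abs_im (a - b)
    simp only [Complex.sub_re, Complex.sub_im] at h2
    rw [show a.re - z.re - (b.re - z.re) = a.re - b.re by ring] at hre
    linarith
  calc ∑ a ∈ s, (1 + ‖z - a‖) ^ (-p) ≤ ∑ a ∈ s, h (φ a) := by
        refine Finset.sum_le_sum fun a ha => ?_
        have hI : ⌊a.im / d⌋ ∈ I := by
          have := abs_le.1 (hZim a (hs a ha))
          refine Finset.mem_Icc.2 ⟨Int.floor_le_floor ?_, Int.floor_le_floor ?_⟩ <;>
            · gcongr
              linarith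
        simp only [hh, hφ]
        rw [Set.indicator_of_mem (by exact_mod_cast hI), mul_one,
          ← Real.mul_rpow hc0.le (by positivity)]
        refine Real.rpow_le_rpow_of_nonpos (by positivity) ?_ (by linarith)
        set k := ⌊(a.re - z.re) / d⌋ with hk
        have hk1 : (k : ℝ) * d ≤ a.re - z.re := by
          rw [← le_div_iff₀ hd0]
          exact Int.floor_le _
        have hk2 : a.re - z.re < (k + 1) * d := by
          rw [← div_lt_iff₀ hd0]
          exact Int.lt_floor_add_one _
        have h3 : |a.re - z.re| ≤ ‖z - a‖ := by
          have := Complex.abs_re_le_norm (z - a)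
          rwa [Complex.sub_re, abs_sub_comm] at this
        have h4 : d * (|(k : ℝ)| - 1) ≤ ‖z - a‖ := by
          rcases abs_cases (k : ℝ) with ⟨e, _⟩ | ⟨e, _⟩ <;> rw [e]
          · nlinarith [le_abs_self (a.re - z.re)]
          · nlinarith [neg_abs_le (a.re - z.re)]
        have hc1 : c ≤ d := min_le_left _ _
        have hc2 : c ≤ 1 / 2 := min_le_right _ _
        rcases le_total |(k : ℝ)| 1 with h5 | h5
        · nlinarith [norm_nonneg (z - a)]
        · nlinarith
    _ = ∑ x ∈ s.image φ, h x := (Finset.sum_image fun a ha b hb => hinj ha hb).symm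
    _ ≤ ∑' x, h x := hsum.sum_le_tsum _ fun x _ => hh0 x

/-- Half a power of the larger of `x` and `y` is traded for a power of `t`; the exponent `3 / 2`
that remains is still larger than `1`. -/
theorem inv_mul_inv_le_rpow {x y t : ℝ} (hx : 0 < x) (hy : 0 < y) (ht : 0 < t)
    (h : 2 * t ≤ x + y) :
    (x * y)⁻¹ ≤ t ^ (-(1 / 2) : ℝ) * (x ^ (-(3 / 2) : ℝ) + y ^ (-(3 / 2) : ℝ)) := by
  wlog hxy : x ≤ y generalizing x y
  · have := this hy hx (by linarith) (by linarith)
    rwa [mul_comm y x, add_comm (y ^ _)] at this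
  have h1 : (x * y)⁻¹ = y ^ (-(1 / 2) : ℝ) * (y ^ (-(1 / 2) : ℝ) * x⁻¹) := by
    rw [← mul_assoc, ← Real.rpow_add hy, mul_inv, mul_comm]
    norm_num [Real.rpow_neg_one]
  have h2 : x ^ (-(3 / 2) : ℝ) = x ^ (-(1 / 2) : ℝ) * x⁻¹ := by
    rw [← Real.rpow_neg_one x, ← Real.rpow_add hx]
    norm_num
  rw [h1]
  have h3 : y ^ (-(1 / 2) : ℝ) ≤ t ^ (-(1 / 2) : ℝ) :=
    Real.rpow_le_rpow_of_nonpos ht (by linarith) (by norm_num)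
  have h4 : y ^ (-(1 / 2) : ℝ) * x⁻¹ ≤ x ^ (-(3 / 2) : ℝ) + y ^ (-(3 / 2) : ℝ) := by
    rw [h2]
    have : y ^ (-(1 / 2) : ℝ) ≤ x ^ (-(1 / 2) : ℝ) :=
      Real.rpow_le_rpow_of_nonpos hx hxy (by norm_num)
    have h5 : y ^ (-(1 / 2) : ℝ) * x⁻¹ ≤ x ^ (-(1 / 2) : ℝ) * x⁻¹ := by gcongr
    have : 0 < y ^ (-(3 / 2) : ℝ) := by positivity
    linarith
  gcongr

/-! ### Two-sided bounds for sine-type functions -/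

namespace IsSineType

variable {S : ℂ → ℂ} {σ : ℝ}

/-- The upper bound for a sine-type function holds on the whole plane, by the Phragmén-Lindelöf
principle in the strip around the real axis. -/
theorem exists_norm_le (hS : IsSineType S σ) (hσ : 0 ≤ σ) :
    ∃ B : ℝ, 0 < B ∧ ∀ z : ℂ, ‖S z‖ ≤ B * Real.exp (σ * |z.im|) := by
  obtain ⟨A, B, H, hA, hB, hH, hAB⟩ := hS.bounds
  obtain ⟨τ, hτ⟩ := hS.expType
  obtain ⟨C, hC⟩ := hτ 1 one_pos
  have hexp : 1 ≤ Real.exp (σ * H) := Real.one_le_exp (by positivity)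
  refine ⟨B * Real.exp (σ * H), by positivity, fun z => ?_⟩
  have hz1 : 1 ≤ Real.exp (σ * |z.im|) := Real.one_le_exp (by positivity)
  rcases le_total H |z.im| with h | h
  · calc ‖S z‖ ≤ B * Real.exp (σ * |z.im|) := (hAB z h).2
      _ ≤ B * Real.exp (σ * H) * Real.exp (σ * |z.im|) := by
        gcongr
        exact le_mul_of_one_le_right hB.le hexp
  · refine le_trans ?_ (le_mul_of_one_le_right (by positivity) hz1)
    have hedge : ∀ w : ℂ, |w.im| = H → ‖S w‖ ≤ B * Real.exp (σ * H) := fun w hw => by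
      have := (hAB w hw.ge).2
      rwa [hw] at this
    refine PhragmenLindelof.horizontal_strip (a := -H) (b := H) hS.entire.diffContOnCl
      ?_ (fun w hw => hedge w (by rw [hw, abs_neg, abs_of_pos hH]))
      (fun w hw => hedge w (by rw [hw, abs_of_pos hH])) (abs_le.1 h).1 (abs_le.1 h).2
    set k := Real.pi / (4 * H) with hk
    have hk0 : 0 < k := by positivity
    refine ⟨k, ?_, (|τ| + 1) * (1 / k + H), IsBigO.of_bound |C| ?_⟩
    · rw [hk]
      exact div_lt_div_of_pos_left Real.pi_pos (by linarith) (by linarith)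
    · refine eventually_inf_principal.2 (Eventually.of_forall fun w hw => ?_)
      have him : |w.im| ≤ H := abs_le.2 ⟨hw.1.le, hw.2.le⟩
      rw [Real.norm_of_nonneg (Real.exp_pos _).le]
      refine (hC w).trans (mul_le_mul (le_abs_self C) (Real.exp_le_exp.2 ?_)
        (Real.exp_pos _).le (abs_nonneg _))
      have h1 : |w.re| ≤ 1 / k * Real.exp (k * |w.re|) := by
        rw [one_div, ← div_eq_inv_mul, le_div_iff₀ hk0]
        linarith [Real.add_one_le_exp (k * |w.re|)]
      have h2 : 1 ≤ Real.exp (k * |w.re|) := Real.one_le_exp (by positivity)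
      calc (τ + 1) * ‖w‖ ≤ (|τ| + 1) * (|w.re| + |w.im|) := by
            gcongr
            · exact le_abs_self τ
            · exact Complex.norm_le_abs_re_add_abs_im w
        _ ≤ (|τ| + 1) * (1 / k * Real.exp (k * |w.re|) + H * Real.exp (k * |w.re|)) := by
            gcongr
            exact him.trans (le_mul_of_one_le_right hH.le h2)
        _ = _ := by ring

theorem exists_abs_im_le (hS : IsSineType S σ) :
    ∃ H : ℝ, 0 < H ∧ ∀ a : ℂ, S a = 0 → |a.im| ≤ H := by
  obtain ⟨A, B, H, hA, hB, hH, hAB⟩ := hS.bounds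
  refine ⟨H, hH, fun a ha => ?_⟩
  by_contra! h
  have := (hAB a h.le).1
  rw [ha, norm_zero] at this
  have : 0 < A * Real.exp (σ * |a.im|) := by positivity
  linarith

theorem exists_sum_zeros_le (hS : IsSineType S σ) {p : ℝ} (hp : 1 < p) :
    ∃ K : ℝ, ∀ (z : ℂ) (s : Finset ℂ), (∀ a ∈ s, S a = 0) →
      ∑ a ∈ s, (1 + ‖z - a‖) ^ (-p) ≤ K := by
  obtain ⟨δ, hδ, hsep⟩ := hS.separated_zeros
  obtain ⟨H, -, hH⟩ := hS.exists_abs_im_le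
  exact exists_sum_one_add_norm_rpow_le (Z := {a | S a = 0}) hδ hp hH
    fun a ha b hb => hsep a b ha hb

theorem exists_card_zeros_le (hS : IsSineType S σ) (R : ℝ) :
    ∃ N : ℕ, ∀ (c : ℂ) (s : Finset ℂ), (∀ a ∈ s, S a = 0 ∧ a ∈ Metric.ball c R) → s.card ≤ N := by
  obtain ⟨K, hK⟩ := hS.exists_sum_zeros_le one_lt_two
  refine ⟨⌈K * (1 + R) ^ (2 : ℝ)⌉₊, fun c s hs => ?_⟩
  rcases s.eq_empty_or_nonempty with rfl | ⟨a₀, ha₀⟩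
  · simp
  have hR : 0 < R := dist_nonneg.trans_lt (hs a₀ ha₀).2
  have h1 : (s.card : ℝ) * (1 + R) ^ (-2 : ℝ) ≤ K := by
    refine le_trans ?_ (hK c s fun a ha => (hs a ha).1)
    rw [← nsmul_eq_mul]
    refine Finset.card_nsmul_le_sum _ _ _ fun a ha => ?_
    refine Real.rpow_le_rpow_of_nonpos (by positivity) ?_ (by norm_num)
    have := (hs a ha).2
    rw [Metric.mem_ball, dist_comm, dist_eq_norm] at this
    linarith
  rw [Real.rpow_neg (by positivity), ← div_eq_mul_inv, div_le_iff₀ (by positivity)] at h1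
  exact_mod_cast h1.trans (Nat.le_ceil _)

/-- The lower bound for a sine-type function holds at all points of the plane whose distance to
the zeros is at least `ε`. -/
theorem exists_le_norm_of_zeros_far (hS : IsSineType S σ) (hσ : 0 ≤ σ) {ε : ℝ} (hε : 0 < ε) :
    ∃ κ : ℝ, 0 < κ ∧ ∀ z : ℂ, (∀ a, S a = 0 → ε ≤ ‖z - a‖) →
      κ * Real.exp (σ * |z.im|) ≤ ‖S z‖ := by
  obtain ⟨A, B₀, H, hA, -, hH, hAB⟩ := hS.bounds
  obtain ⟨B, hB, hSB⟩ := hS.exists_norm_le hσ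
  obtain ⟨N, hN⟩ := hS.exists_card_zeros_le (4 * H)
  -- The constants depend on the number `n` of zeros in the disc, which is at most `N`.
  choose κ hκ hκS using fun n => exists_pos_le_norm_of_card_zeros (r := 2 * H) (R := 4 * H)
    (by positivity) (by linarith) hε n A (B * Real.exp (σ * (9 * H))) hA
  obtain ⟨n₀, -, hn₀⟩ := Finset.exists_min_image (Finset.range (N + 1)) κ ⟨0, by simp⟩
  set κ' := κ n₀ * Real.exp (-(σ * H)) with hκ'
  have hκ'0 : 0 < κ' := mul_pos (hκ n₀) (Real.exp_pos _)
  refine ⟨min A κ', lt_min hA hκ'0, fun z hz => ?_⟩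
  rcases le_total H |z.im| with h | h
  · refine le_trans ?_ (hAB z h).1
    gcongr
    exact min_le_left _ _
  -- The disc is centred at the point `c` above `z` with imaginary part `H`; `‖z - c‖ ≤ 2 * H`.
  set c : ℂ := ⟨z.re, H⟩ with hc
  set f : ℂ → ℂ := fun w => S (c + w) with hf
  have hfin : {w : ℂ | w ∈ Metric.ball (0 : ℂ) (4 * H) ∧ f w = 0}.Finite := by
    by_contra hinf
    obtain ⟨s, hs, hsN⟩ := Set.Infinite.exists_subset_card_eq hinf (N + 1)
    have := hN c (s.map (addLeftEmbedding c)) (fun a ha => by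
      obtain ⟨w, hw, rfl⟩ := Finset.mem_map.1 ha
      have := hs hw
      exact ⟨this.2, by simpa using this.1⟩)
    rw [Finset.card_map] at this
    omega
  set Z := hfin.toFinset with hZ
  have hZmem : ∀ w, w ∈ Z ↔ w ∈ Metric.ball (0 : ℂ) (4 * H) ∧ f w = 0 := by simp [hZ]
  have hZN : Z.card ≤ N := by
    have := hN c (Z.map (addLeftEmbedding c)) (fun a ha => by
      obtain ⟨w, hw, rfl⟩ := Finset.mem_map.1 ha
      have := (hZmem w).1 hw
      exact ⟨this.2, by simpa using this.1⟩)
    rwa [Finset.card_map] at this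
  have hzc : c + (z - c) = z := by ring
  have key : κ Z.card ≤ ‖S z‖ := by
    have := hκS Z.card f Z (hS.entire.comp (by fun_prop)) rfl hZmem (fun w hw => ?_)
      (fun w hw => ?_) ?_ (z - c) ?_ (fun a ha => ?_)
    · simpa [hf] using this
    · rw [hf, deriv_comp_const_add]
      exact hS.simple_zeros _ ((hZmem w).1 hw).2
    · refine (hSB _).trans ?_
      gcongr
      have h1 : |w.im| < 2 * (4 * H) := (Complex.abs_im_le_norm w).trans_lt (by simpa using hw)
      calc |(c + w).im| ≤ |H| + |w.im| := abs_add_le H w.im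
        _ ≤ 9 * H := by rw [abs_of_pos hH]; linarith
    · have hcim : |c.im| = H := abs_of_pos hH
      have := (hAB c hcim.ge).1
      simp only [hf, add_zero]
      refine le_trans (le_mul_of_one_le_right hA.le (Real.one_le_exp (by positivity))) this
    · refine (Complex.norm_le_abs_re_add_abs_im _).trans ?_
      have := abs_le.1 h
      simp only [hc, Complex.sub_re, Complex.sub_im, sub_self, abs_zero, zero_add]
      exact abs_le.2 ⟨by linarith, by linarith⟩
    · have := hz (c + a) ((hZmem a).1 ha).2
      rwa [sub_sub]
  calc min A κ' * Real.exp (σ * |z.im|) ≤ κ' * Real.exp (σ * H) := by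
        gcongr
        exact min_le_right _ _
    _ = κ n₀ := by rw [hκ', mul_assoc, ← Real.exp_add]; simp
    _ ≤ κ Z.card := hn₀ _ (Finset.mem_range.2 (by omega))
    _ ≤ ‖S z‖ := key

/-- Circles of a suitable radius `ε` around the zeros keep the distance `ε` from all zeros,
and each of these discs contains no other zero. -/
theorem exists_sphere_zeros_far (hS : IsSineType S σ) :
    ∃ ε : ℝ, 0 < ε ∧ ε ≤ 1 ∧ (∀ a b : ℂ, S a = 0 → S b = 0 → a ≠ b → 2 * ε ≤ ‖a - b‖) ∧
      ∀ a w : ℂ, S a = 0 → ‖w - a‖ = ε → ∀ b, S b = 0 → ε ≤ ‖w - b‖ := by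
  obtain ⟨δ, hδ, hsep⟩ := hS.separated_zeros
  have hε := min_le_left (δ / 2) 1
  refine ⟨min (δ / 2) 1, by positivity, min_le_right _ _,
    fun a b ha hb hne => by linarith [hsep a b ha hb hne], fun a w ha hw b hb => ?_⟩
  rcases eq_or_ne a b with rfl | hne
  · exact hw.ge
  · have h1 := hsep a b ha hb hne
    have h2 : ‖a - b‖ ≤ ‖w - a‖ + ‖w - b‖ := by
      rw [← norm_sub_rev a w]
      exact norm_sub_le_norm_sub_add_norm_sub a w b
    linarith

/-- The derivative is bounded below at the zeros, by the minimum principle for `S w / (w - a)` on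
a small disc around the zero `a`. -/
theorem exists_le_norm_deriv (hS : IsSineType S σ) (hσ : 0 ≤ σ) :
    ∃ κ : ℝ, 0 < κ ∧ ∀ a : ℂ, S a = 0 → κ ≤ ‖deriv S a‖ := by
  obtain ⟨ε, hε, -, hsep, hfar⟩ := hS.exists_sphere_zeros_far
  obtain ⟨κ, hκ, hκS⟩ := hS.exists_le_norm_of_zeros_far hσ hε
  refine ⟨κ / ε, by positivity, fun a ha => ?_⟩
  set g := dslope S a with hg
  have hga : g a = deriv S a := by simp [hg]
  have hgne : ∀ w ∈ Metric.closedBall a ε, g w ≠ 0 := by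
    intro w hw h0
    rcases eq_or_ne w a with rfl | hne
    · exact hS.simple_zeros w ha (hga ▸ h0)
    · rw [hg, dslope_eq_div ha hne, div_eq_zero_iff, or_iff_left (sub_ne_zero.2 hne)] at h0
      have h1 := hsep w a h0 ha hne
      rw [Metric.mem_closedBall, dist_eq_norm] at hw
      linarith
  have hdiff : DiffContOnCl ℂ (fun w => (g w)⁻¹) (Metric.ball a ε) := by
    refine DifferentiableOn.diffContOnCl ?_
    rw [closure_ball _ hε.ne']
    exact (hS.entire.dslope a).differentiableOn.inv hgne
  have := Complex.norm_le_of_forall_mem_frontier_norm_le Metric.isBounded_ball hdiff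
    (C := ε / κ) (fun w hw => ?_) (subset_closure (Metric.mem_ball_self hε))
  · rw [hga, norm_inv] at this
    have hd : 0 < ‖deriv S a‖ := norm_pos_iff.2 (hS.simple_zeros a ha)
    rw [inv_le_comm₀ hd (by positivity), inv_div] at this
    exact this
  · rw [frontier_ball _ hε.ne', mem_sphere_iff_norm] at hw
    have hne : w ≠ a := by
      rintro rfl
      simp at hw
      exact hε.ne hw
    have h1 := hκS w (hfar a w ha hw)
    have h2 : κ ≤ ‖S w‖ :=
      (le_mul_of_one_le_right hκ.le (Real.one_le_exp (by positivity))).trans h1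
    rw [hg, dslope_eq_div ha hne, inv_div, norm_div, hw]
    gcongr

end IsSineType

/-! ### Quotients of entire functions -/

/-- Liouville's theorem for an entire function that is `o(‖z‖)` off the discs of radius `ε` around
the points of `Z`, provided the boundaries of these discs avoid the other discs: the maximum
principle extends the growth bound into the discs. -/
theorem apply_eq_apply_of_sublinear_off_discs {h : ℂ → ℂ} (hd : Differentiable ℂ h) {Z : Set ℂ}
    {ε : ℝ} (hε : 0 < ε) (hε1 : ε ≤ 1) (hZ : ∀ a ∈ Z, ∀ w, ‖w - a‖ = ε → ∀ b ∈ Z, ε ≤ ‖w - b‖)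
    (hh : ∀ η : ℝ, 0 < η → ∃ R : ℝ, ∀ z : ℂ, R ≤ ‖z‖ → (∀ a ∈ Z, ε ≤ ‖z - a‖) →
      ‖h z‖ ≤ η * ‖z‖) (z w : ℂ) : h z = h w := by
  refine is_const_of_deriv_eq_zero hd (fun v => ?_) z w
  rw [← norm_le_zero_iff]
  refine le_of_forall_pos_le_add fun η hη => ?_
  rw [zero_add]
  obtain ⟨R, hR⟩ := hh (η / 2) (by positivity)
  have hall : ∀ z : ℂ, R + 2 ≤ ‖z‖ → ‖h z‖ ≤ η / 2 * (‖z‖ + 2) := by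
    intro z hz
    by_cases hfar : ∀ a ∈ Z, ε ≤ ‖z - a‖
    · exact (hR z (by linarith) hfar).trans (by gcongr; linarith)
    · push Not at hfar
      obtain ⟨a, ha, hza⟩ := hfar
      refine Complex.norm_le_of_forall_mem_frontier_norm_le (U := Metric.ball a ε)
        Metric.isBounded_ball hd.diffContOnCl (fun u hu => ?_)
        (subset_closure (by simpa [dist_eq_norm] using hza))
      rw [frontier_ball _ hε.ne', mem_sphere_iff_norm] at hu
      have h1 : ‖u - z‖ ≤ 2 := by
        have := norm_sub_le_norm_sub_add_norm_sub u a z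
        rw [norm_sub_rev a z] at this
        linarith
      have h2 : ‖z‖ - ‖u‖ ≤ ‖u - z‖ := by
        rw [norm_sub_rev]
        exact norm_sub_norm_le z u
      have h3 : ‖u‖ - ‖z‖ ≤ ‖u - z‖ := norm_sub_norm_le u z
      refine (hR u (by linarith) fun b hb => hZ a ha u hu b hb).trans ?_
      gcongr
      linarith
  -- The Cauchy estimate on a circle whose radius `ρ` dominates `R` and `‖v‖`.
  set ρ : ℝ := |R| + 2 + ‖v‖ with hρ
  have hρ0 : 0 < ρ := by positivity
  refine (Complex.norm_deriv_le_of_forall_mem_sphere_norm_le hρ0 hd.diffContOnCl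
    (C := η * ρ) fun u hu => ?_).trans_eq (mul_div_cancel_right₀ η hρ0.ne')
  rw [mem_sphere_iff_norm] at hu
  have h1 : ‖u - v‖ ≤ ‖u‖ + ‖v‖ := norm_sub_le u v
  have h2 : ‖u‖ ≤ ‖u - v‖ + ‖v‖ := by
    have := norm_sub_norm_le u v
    linarith
  calc ‖h u‖ ≤ η / 2 * (‖u‖ + 2) := hall u (by linarith [le_abs_self R])
    _ ≤ η / 2 * (2 * ρ) := by
      gcongr
      linarith [abs_nonneg R]
    _ = η * ρ := by ring

theorem exists_differentiable_eq_mul {S G : ℂ → ℂ} (hS : Differentiable ℂ S)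
    (hG : Differentiable ℂ G) (hsimple : ∀ z, S z = 0 → deriv S z ≠ 0)
    (hzero : ∀ z, S z = 0 → G z = 0) :
    ∃ h : ℂ → ℂ, Differentiable ℂ h ∧ ∀ z, G z = h z * S z := by
  classical
  refine ⟨fun z => if S z = 0 then deriv G z / deriv S z else G z / S z, fun a => ?_, fun z => ?_⟩
  · by_cases ha : S a = 0
    · have hne : dslope S a a ≠ 0 := by
        rw [dslope_same]
        exact hsimple a ha
      have hd : DifferentiableAt ℂ (fun z => dslope G a z / dslope S a z) a :=
        (hG.dslope a a).div (hS.dslope a a) hne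
      refine hd.congr_of_eventuallyEq ?_
      filter_upwards [(hS.dslope a).continuous.continuousAt.eventually_ne hne] with z hz
      rcases eq_or_ne z a with rfl | hza
      · simp [ha]
      · rw [dslope_eq_div ha hza] at hz
        have hSz : S z ≠ 0 := fun h => hz (by rw [h, zero_div])
        simp only [hSz, if_false]
        rw [dslope_eq_div ha hza, dslope_eq_div (hzero a ha) hza,
          div_div_div_cancel_right₀ (sub_ne_zero.2 hza)]
    · refine ((hG a).div (hS a) ha).congr_of_eventuallyEq ?_
      filter_upwards [hS.continuous.continuousAt.eventually_ne ha] with z hz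
      simp [hz]
  · by_cases hz : S z = 0
    · simp [hz, hzero z hz]
    · simp [hz]

theorem exists_pos_le_norm_of_simple_zeros {S : ℂ → ℂ} (hS : Differentiable ℂ S)
    (hsimple : ∀ z, S z = 0 → deriv S z ≠ 0) :
    ∃ ρ : ℝ, 0 < ρ ∧ ∀ a, S a = 0 → a ≠ 0 → ρ ≤ ‖a‖ := by
  have hev : ∀ᶠ z in 𝓝[≠] (0 : ℂ), S z ≠ 0 := by
    by_cases h0 : S 0 = 0
    · have := (hS 0).hasDerivAt.eventually_ne (c := 0) (hsimple 0 h0)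
      simpa using this
    · exact (hS.continuous.continuousAt.eventually_ne h0).filter_mono nhdsWithin_le_nhds
  rw [eventually_nhdsWithin_iff, Metric.eventually_nhds_iff] at hev
  obtain ⟨ρ, hρ, h⟩ := hev
  refine ⟨ρ, hρ, fun a ha ha0 => ?_⟩
  by_contra! hlt
  exact h (by simpa using hlt) ha0 ha

/-! ### Estimates of the Lagrange kernels -/

theorem lagrangeKernel_eq_dslope {S : ℂ → ℂ} {a : ℂ} (ha : S a = 0) (hd : deriv S a ≠ 0) (z : ℂ) :
    lagrangeKernel S a z = dslope S a z / deriv S a := by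
  rw [lagrangeKernel]
  split_ifs with h
  · rw [h, dslope_same, div_self hd]
  · rw [dslope_eq_div ha h, div_div, mul_comm]

/-- The two terms of the modified kernel combine to a product, since
`1 / (z - a) + 1 / a = z / (a * (z - a))`. -/
theorem modifiedLagrangeKernel_eq_mul {S : ℂ → ℂ} {a : ℂ} (ha : S a = 0) (z : ℂ) :
    modifiedLagrangeKernel S a z = lagrangeKernel S a z * if a = 0 then 1 else z / a := by
  rw [modifiedLagrangeKernel, lagrangeKernel]
  split_ifs with h1 h2 h2
  · simp
  · rw [h1, ha, div_self h2]
    simp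
  · simp
  · have := sub_ne_zero.2 h1
    rcases eq_or_ne (deriv S a) 0 with h | h
    · simp [h]
    · field_simp
      ring

theorem modifiedLagrangeKernel_self {S : ℂ → ℂ} {a : ℂ} (ha : S a = 0) :
    modifiedLagrangeKernel S a a = 1 := by
  rw [modifiedLagrangeKernel_eq_mul ha, lagrangeKernel, if_pos rfl, one_mul]
  split_ifs with h
  · rfl
  · exact div_self h

theorem modifiedLagrangeKernel_of_ne {S : ℂ → ℂ} {a b : ℂ} (hb : S b = 0) (h : b ≠ a) :
    modifiedLagrangeKernel S a b = 0 := by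
  simp [modifiedLagrangeKernel, lagrangeKernel, h, hb]

namespace IsSineType

variable {S : ℂ → ℂ} {σ : ℝ}

theorem differentiable_modifiedLagrangeKernel (hS : IsSineType S σ) {a : ℂ} (ha : S a = 0) :
    Differentiable ℂ (modifiedLagrangeKernel S a) := by
  have h : modifiedLagrangeKernel S a =
      fun z => dslope S a z / deriv S a * if a = 0 then 1 else z / a := by
    funext z
    rw [modifiedLagrangeKernel_eq_mul ha, lagrangeKernel_eq_dslope ha (hS.simple_zeros a ha)]
  rw [h]
  have := hS.entire.dslope a
  split_ifs <;> fun_prop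

/-- Away from `a`, by the upper bound for `S` and the lower bound for its derivative at the zeros;
in the unit disc around `a`, by the maximum principle. -/
theorem exists_norm_lagrangeKernel_le (hS : IsSineType S σ) (hσ : 0 ≤ σ) :
    ∃ K : ℝ, 0 < K ∧ ∀ a z : ℂ, S a = 0 →
      ‖lagrangeKernel S a z‖ ≤ K * Real.exp (σ * |z.im|) * (1 + ‖z - a‖)⁻¹ := by
  obtain ⟨B, hB, hSB⟩ := hS.exists_norm_le hσ
  obtain ⟨κ, hκ, hκS⟩ := hS.exists_le_norm_deriv hσ
  obtain ⟨H, hH, hHS⟩ := hS.exists_abs_im_le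
  have hfar : ∀ a z : ℂ, S a = 0 → 1 ≤ ‖z - a‖ →
      ‖lagrangeKernel S a z‖ ≤ B / κ * Real.exp (σ * |z.im|) * ‖z - a‖⁻¹ := by
    intro a z ha hz
    have hne : z ≠ a := by
      rintro rfl
      simp at hz
      linarith
    rw [lagrangeKernel, if_neg hne, norm_div, norm_mul]
    calc ‖S z‖ / (‖deriv S a‖ * ‖z - a‖) ≤ B * Real.exp (σ * |z.im|) / (κ * ‖z - a‖) := by
          have := hSB z
          have := hκS a ha
          gcongr
      _ = _ := by field_simp
  refine ⟨2 * (B / κ * Real.exp (σ * (H + 1))), by positivity, fun a z ha => ?_⟩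
  have he : 1 ≤ Real.exp (σ * (H + 1)) := Real.one_le_exp (by positivity)
  have he' : 1 ≤ Real.exp (σ * |z.im|) := Real.one_le_exp (by positivity)
  rcases le_total 1 ‖z - a‖ with h | h
  · refine (hfar a z ha h).trans ?_
    have h1 : ‖z - a‖⁻¹ ≤ 2 * (1 + ‖z - a‖)⁻¹ := by
      rw [← div_eq_mul_inv, inv_le_comm₀ (by linarith) (by positivity), inv_div]
      linarith
    calc B / κ * Real.exp (σ * |z.im|) * ‖z - a‖⁻¹
        ≤ B / κ * Real.exp (σ * |z.im|) * (2 * (1 + ‖z - a‖)⁻¹) := by gcongr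
      _ ≤ B / κ * Real.exp (σ * |z.im|) * (2 * (1 + ‖z - a‖)⁻¹) * Real.exp (σ * (H + 1)) :=
        le_mul_of_one_le_right (by positivity) he
      _ = _ := by ring
  · have h1 : ‖lagrangeKernel S a z‖ ≤ B / κ * Real.exp (σ * (H + 1)) := by
      refine Complex.norm_le_of_forall_mem_frontier_norm_le (U := Metric.ball a 1)
        Metric.isBounded_ball (f := lagrangeKernel S a) ?_ (fun w hw => ?_) ?_
      · rw [funext (lagrangeKernel_eq_dslope ha (hS.simple_zeros a ha))]
        exact ((hS.entire.dslope a).div_const _).diffContOnCl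
      · rw [frontier_ball _ one_ne_zero, mem_sphere_iff_norm] at hw
        have h2 := hfar a w ha hw.ge
        rw [hw, inv_one, mul_one] at h2
        refine h2.trans ?_
        gcongr
        have h3 := abs_sub_abs_le_abs_sub w.im a.im
        have h4 := Complex.abs_im_le_norm (w - a)
        rw [Complex.sub_im] at h4
        linarith [hHS a ha]
      · rw [closure_ball _ one_ne_zero]
        simpa [dist_eq_norm] using h
    have h2 : 1 ≤ 2 * (1 + ‖z - a‖)⁻¹ := by
      rw [← div_eq_mul_inv, one_le_div (by positivity)]
      linarith
    calc ‖lagrangeKernel S a z‖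
        ≤ B / κ * Real.exp (σ * (H + 1)) * (2 * (1 + ‖z - a‖)⁻¹) :=
          h1.trans (le_mul_of_one_le_right (by positivity) h2)
      _ ≤ B / κ * Real.exp (σ * (H + 1)) * (2 * (1 + ‖z - a‖)⁻¹) * Real.exp (σ * |z.im|) :=
          le_mul_of_one_le_right (by positivity) he'
      _ = _ := by ring

/-- The square root of `1 + ‖z‖`, in place of its first power, is what makes the series grow
sublinearly; the weights in the last factor are summable over the zeros. -/
theorem exists_norm_modifiedLagrangeKernel_le (hS : IsSineType S σ) (hσ : 0 ≤ σ) :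
    ∃ K : ℝ, 0 < K ∧ ∀ a z : ℂ, S a = 0 → ‖modifiedLagrangeKernel S a z‖ ≤
      K * Real.exp (σ * |z.im|) * (1 + ‖z‖) ^ (1 / 2 : ℝ) *
        ((1 + ‖a‖) ^ (-(3 / 2) : ℝ) + (1 + ‖z - a‖) ^ (-(3 / 2) : ℝ)) := by
  obtain ⟨K, hK, hKS⟩ := hS.exists_norm_lagrangeKernel_le hσ
  obtain ⟨ρ, hρ, hρS⟩ := exists_pos_le_norm_of_simple_zeros hS.entire hS.simple_zeros
  have hfactor : ∀ a z : ℂ, S a = 0 →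
      ‖if a = 0 then 1 else z / a‖ ≤ (1 + 1 / ρ) * (1 + ‖z‖) * (1 + ‖a‖)⁻¹ := by
    intro a z ha
    split_ifs with h
    · have : 0 < 1 / ρ := by positivity
      rw [h]
      simp only [norm_zero, norm_one, add_zero, inv_one, mul_one]
      nlinarith [norm_nonneg z]
    · have ha0 : 0 < ‖a‖ := norm_pos_iff.2 h
      rw [norm_div, ← div_eq_mul_inv, div_le_div_iff₀ ha0 (by positivity)]
      have h1 : 1 + ‖a‖ ≤ (1 + 1 / ρ) * ‖a‖ := by
        have : 1 ≤ 1 / ρ * ‖a‖ := by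
          rw [one_div, ← div_eq_inv_mul, one_le_div hρ]
          exact hρS a ha h
        linarith
      calc ‖z‖ * (1 + ‖a‖) ≤ (1 + ‖z‖) * ((1 + 1 / ρ) * ‖a‖) := by
            gcongr
            linarith
        _ = _ := by ring
  refine ⟨K * (1 + 1 / ρ) * 2 ^ (1 / 2 : ℝ), by positivity, fun a z ha => ?_⟩
  rw [modifiedLagrangeKernel_eq_mul ha, norm_mul]
  have hz : 0 < 1 + ‖z‖ := by positivity
  have h1 := inv_mul_inv_le_rpow (x := 1 + ‖a‖) (y := 1 + ‖z - a‖) (t := (1 + ‖z‖) / 2)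
    (by positivity) (by positivity) (by positivity) (by
      have := norm_sub_norm_le z a
      linarith)
  have h2 : (1 + ‖z‖) * ((1 + ‖z‖) / 2) ^ (-(1 / 2) : ℝ) =
      2 ^ (1 / 2 : ℝ) * (1 + ‖z‖) ^ (1 / 2 : ℝ) := by
    rw [Real.rpow_neg (by positivity), Real.div_rpow hz.le two_pos.le, inv_div]
    have h3 : (1 + ‖z‖) = (1 + ‖z‖) ^ (1 / 2 : ℝ) * (1 + ‖z‖) ^ (1 / 2 : ℝ) := by
      rw [← Real.rpow_add hz]
      norm_num
    have h4 : (1 + ‖z‖) ^ (1 / 2 : ℝ) ≠ 0 := by positivity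
    rw [mul_div_assoc', div_eq_iff h4]
    nth_rewrite 1 [h3]
    ring
  calc ‖lagrangeKernel S a z‖ * ‖if a = 0 then 1 else z / a‖
      ≤ (K * Real.exp (σ * |z.im|) * (1 + ‖z - a‖)⁻¹) *
          ((1 + 1 / ρ) * (1 + ‖z‖) * (1 + ‖a‖)⁻¹) :=
        mul_le_mul (hKS a z ha) (hfactor a z ha) (norm_nonneg _) (by positivity)
    _ = K * (1 + 1 / ρ) * Real.exp (σ * |z.im|) * (1 + ‖z‖) *
          ((1 + ‖a‖) * (1 + ‖z - a‖))⁻¹ := by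
        rw [mul_inv]
        ring
    _ ≤ K * (1 + 1 / ρ) * Real.exp (σ * |z.im|) * (1 + ‖z‖) *
          (((1 + ‖z‖) / 2) ^ (-(1 / 2) : ℝ) *
            ((1 + ‖a‖) ^ (-(3 / 2) : ℝ) + (1 + ‖z - a‖) ^ (-(3 / 2) : ℝ))) := by
        gcongr
    _ = K * (1 + 1 / ρ) * Real.exp (σ * |z.im|) * ((1 + ‖z‖) * ((1 + ‖z‖) / 2) ^ (-(1 / 2) : ℝ)) *
            ((1 + ‖a‖) ^ (-(3 / 2) : ℝ) + (1 + ‖z - a‖) ^ (-(3 / 2) : ℝ)) := by ring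
    _ = _ := by
        rw [h2]
        ring

theorem exists_summable_zeros (hS : IsSineType S σ) {p : ℝ} (hp : 1 < p) {lam : ℤ → ℂ}
    (hinj : Function.Injective lam) (hlam : ∀ n, S (lam n) = 0) :
    ∃ K : ℝ, ∀ z : ℂ, Summable (fun n => (1 + ‖z - lam n‖) ^ (-p)) ∧
      ∑' n, (1 + ‖z - lam n‖) ^ (-p) ≤ K := by
  obtain ⟨K, hK⟩ := hS.exists_sum_zeros_le hp
  have h : ∀ (z : ℂ) (s : Finset ℤ), ∑ n ∈ s, (1 + ‖z - lam n‖) ^ (-p) ≤ K := by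
    intro z s
    have := hK z (s.map ⟨lam, hinj⟩) (fun a ha => by
      obtain ⟨n, -, rfl⟩ := Finset.mem_map.1 ha
      exact hlam n)
    simpa using this
  refine ⟨K, fun z => ?_⟩
  have hs := summable_of_sum_le (fun n => by positivity) (h z)
  exact ⟨hs, hs.tsum_le_of_sum_le (h z)⟩

end IsSineType

/-! ### Growth conditions -/

theorem IsOfExpType.of_norm_le_sqrt {g : ℂ → ℂ} {σ D : ℝ} (hσ : 0 ≤ σ) (hD : 0 ≤ D)
    (hg : ∀ z, ‖g z‖ ≤ D * Real.exp (σ * |z.im|) * (1 + ‖z‖) ^ (1 / 2 : ℝ)) :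
    IsOfExpType g σ := by
  intro ε hε
  refine ⟨D * (1 + 1 / ε), fun z => (hg z).trans ?_⟩
  have h1 : (1 + ‖z‖) ^ (1 / 2 : ℝ) ≤ 1 + ‖z‖ :=
    Real.rpow_le_self_of_one_le (by linarith [norm_nonneg z]) (by norm_num)
  have h2 : 1 + ‖z‖ ≤ (1 + 1 / ε) * Real.exp (ε * ‖z‖) := by
    have h3 : ‖z‖ ≤ 1 / ε * Real.exp (ε * ‖z‖) := by
      rw [one_div, ← div_eq_inv_mul, le_div_iff₀ hε]
      linarith [Real.add_one_le_exp (ε * ‖z‖)]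
    have h4 : 1 ≤ Real.exp (ε * ‖z‖) := Real.one_le_exp (by positivity)
    linarith
  calc D * Real.exp (σ * |z.im|) * (1 + ‖z‖) ^ (1 / 2 : ℝ)
      ≤ D * Real.exp (σ * ‖z‖) * ((1 + 1 / ε) * Real.exp (ε * ‖z‖)) := by
        gcongr
        · exact Complex.abs_im_le_norm z
        · exact h1.trans h2
    _ = D * (1 + 1 / ε) * Real.exp ((σ + ε) * ‖z‖) := by
        rw [add_mul σ, Real.exp_add]
        ring

theorem HasSublinearGrowth.of_norm_le_sqrt {g : ℂ → ℂ} {σ D : ℝ}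
    (hg : ∀ z, ‖g z‖ ≤ D * Real.exp (σ * |z.im|) * (1 + ‖z‖) ^ (1 / 2 : ℝ)) :
    HasSublinearGrowth g σ := by
  have h1 : (fun z : ℂ => ‖g z‖ * Real.exp (-(σ * |z.im|))) =O[cocompact ℂ]
      fun z => (1 + ‖z‖) ^ (1 / 2 : ℝ) := by
    refine IsBigO.of_bound D (Eventually.of_forall fun z => ?_)
    rw [Real.norm_of_nonneg (by positivity), Real.norm_of_nonneg (by positivity), Real.exp_neg,
      ← div_eq_mul_inv, div_le_iff₀ (Real.exp_pos _)]
    linarith [hg z]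
  refine h1.trans_isLittleO ?_
  have h2 : (fun t : ℝ => (1 + t) ^ (1 / 2 : ℝ)) =o[atTop] fun t : ℝ => t := by
    have h3 : (fun t : ℝ => 1 + t) =O[atTop] fun t : ℝ => t :=
      (isLittleO_const_id_atTop (1 : ℝ)).isBigO.add (isBigO_refl _ _)
    have h4 : (fun t : ℝ => t ^ (1 / 2 : ℝ)) =o[atTop] fun t : ℝ => t := by
      have h5 : (fun t : ℝ => t ^ (1 / 2 : ℝ) * 1) =o[atTop]
          fun t : ℝ => t ^ (1 / 2 : ℝ) * t ^ (1 / 2 : ℝ) :=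
        (isBigO_refl _ _).mul_isLittleO (isLittleO_const_left.2 (Or.inr
          (tendsto_norm_atTop_atTop.comp (tendsto_rpow_atTop (by norm_num)))))
      refine h5.congr' (Eventually.of_forall fun t => mul_one _) ?_
      filter_upwards [eventually_gt_atTop 0] with t ht
      rw [← Real.rpow_add ht]
      norm_num
    exact (h3.rpow (by norm_num) (eventually_ge_atTop 0)).trans_isLittleO h4
  exact h2.comp_tendsto (tendsto_norm_cocompact_atTop (E := ℂ))

theorem HasSublinearGrowth.sub {f g : ℂ → ℂ} {σ : ℝ} (hf : HasSublinearGrowth f σ)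
    (hg : HasSublinearGrowth g σ) : HasSublinearGrowth (fun z => f z - g z) σ := by
  refine (IsBigO.of_bound 1 (Eventually.of_forall fun z => ?_)).trans_isLittleO
    (IsLittleO.add hf hg)
  rw [Real.norm_of_nonneg (by positivity), Real.norm_of_nonneg (by positivity), ← add_mul, one_mul]
  gcongr
  exact norm_sub_le _ _

/-! ### The modified Lagrange series and uniqueness -/

namespace IsSineType

variable {S : ℂ → ℂ} {σ : ℝ}

/-- An entire function of growth `o(‖z‖ * exp (σ * |Im z|))` that vanishes at the zeros of a
sine-type function is a constant multiple of it. -/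
theorem exists_eq_const_mul (hS : IsSineType S σ) (hσ : 0 ≤ σ) {G : ℂ → ℂ}
    (hG : Differentiable ℂ G) (hzero : ∀ z, S z = 0 → G z = 0) (hgrowth : HasSublinearGrowth G σ) :
    ∃ C : ℂ, ∀ z, G z = C * S z := by
  obtain ⟨h, hh, hGh⟩ := exists_differentiable_eq_mul hS.entire hG hS.simple_zeros hzero
  obtain ⟨ε, hε, hε1, -, hfar⟩ := hS.exists_sphere_zeros_far
  obtain ⟨κ, hκ, hκS⟩ := hS.exists_le_norm_of_zeros_far hσ hε
  have hconst : ∀ z w, h z = h w := by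
    refine apply_eq_apply_of_sublinear_off_discs hh (Z := {a | S a = 0}) hε hε1
      (fun a ha w hw b hb => hfar a w ha hw b hb) fun η hη => ?_
    have hev := hgrowth.def (show 0 < η * κ by positivity)
    rw [← Metric.cobounded_eq_cocompact, ← comap_norm_atTop, eventually_comap,
      eventually_atTop] at hev
    obtain ⟨R, hR⟩ := hev
    refine ⟨R, fun z hz hza => ?_⟩
    have h1 := hR ‖z‖ hz z rfl
    rw [Real.norm_of_nonneg (by positivity), norm_norm, hGh, norm_mul, Real.exp_neg,
      ← div_eq_mul_inv, div_le_iff₀ (Real.exp_pos _)] at h1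
    have h2 := mul_le_mul_of_nonneg_left (hκS z hza) (norm_nonneg (h z))
    have h3 : 0 < κ * Real.exp (σ * |z.im|) := by positivity
    refine le_of_mul_le_mul_right ?_ h3
    linarith
  exact ⟨h 0, fun z => by rw [hGh, hconst z 0]⟩

section Series

variable {lam : ℤ → ℂ} {c : ℤ → ℂ}

/-- The estimates of the modified Lagrange series: absolute convergence, growth of the sum, and a
summable majorant on each disc around the origin. -/
theorem exists_tsum_modifiedLagrangeKernel_bounds (hS : IsSineType S σ) (hσ : 0 ≤ σ)
    (hinj : Function.Injective lam) (hlam : ∀ n, S (lam n) = 0) (hc : ∃ M : ℝ, ∀ n, ‖c n‖ ≤ M) :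
    (∀ z, Summable fun n => ‖c n * modifiedLagrangeKernel S (lam n) z‖) ∧
    (∃ D : ℝ, ∀ z, ‖∑' n, c n * modifiedLagrangeKernel S (lam n) z‖ ≤
      D * Real.exp (σ * |z.im|) * (1 + ‖z‖) ^ (1 / 2 : ℝ)) ∧
    ∀ R : ℝ, ∃ u : ℤ → ℝ, Summable u ∧ ∀ n z, ‖z‖ ≤ R →
      ‖c n * modifiedLagrangeKernel S (lam n) z‖ ≤ u n := by
  obtain ⟨M, hM⟩ := hc
  have hM0 : 0 ≤ M := (norm_nonneg _).trans (hM 0)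
  obtain ⟨K, hK, hKS⟩ := hS.exists_norm_modifiedLagrangeKernel_le hσ
  obtain ⟨W, hW⟩ := hS.exists_summable_zeros (show (1 : ℝ) < 3 / 2 by norm_num) hinj hlam
  have hW0 : Summable (fun n => (1 + ‖lam n‖) ^ (-(3 / 2) : ℝ)) ∧
      ∑' n, (1 + ‖lam n‖) ^ (-(3 / 2) : ℝ) ≤ W := by
    simpa using hW 0
  set E : ℂ → ℝ := fun z => M * (K * Real.exp (σ * |z.im|) * (1 + ‖z‖) ^ (1 / 2 : ℝ)) with hE
  have hE0 : ∀ z, 0 ≤ E z := fun z => by positivity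
  have hterm : ∀ n z, ‖c n * modifiedLagrangeKernel S (lam n) z‖ ≤
      E z * ((1 + ‖lam n‖) ^ (-(3 / 2) : ℝ) + (1 + ‖z - lam n‖) ^ (-(3 / 2) : ℝ)) := by
    intro n z
    rw [norm_mul, hE]
    simp only [mul_assoc]
    refine mul_le_mul (hM n) ?_ (norm_nonneg _) hM0
    simpa only [mul_assoc] using hKS (lam n) z (hlam n)
  have hsum : ∀ z, Summable fun n => E z *
      ((1 + ‖lam n‖) ^ (-(3 / 2) : ℝ) + (1 + ‖z - lam n‖) ^ (-(3 / 2) : ℝ)) :=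
    fun z => (hW0.1.add (hW z).1).mul_left _
  have habs : ∀ z, Summable fun n => ‖c n * modifiedLagrangeKernel S (lam n) z‖ :=
    fun z => (hsum z).of_nonneg_of_le (fun n => norm_nonneg _) fun n => hterm n z
  refine ⟨habs, ⟨M * K * (W + W), fun z => ?_⟩, fun R => ?_⟩
  · refine (tsum_of_norm_bounded (hsum z).hasSum fun n => hterm n z).trans ?_
    rw [tsum_mul_left, hW0.1.tsum_add (hW z).1]
    calc E z * _ ≤ E z * (W + W) :=
          mul_le_mul_of_nonneg_left (add_le_add hW0.2 (hW z).2) (hE0 z)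
      _ = _ := by
          rw [hE]
          ring
  · refine ⟨fun n => M * (K * Real.exp (σ * |R|) * (1 + |R|) ^ (1 / 2 : ℝ)) *
      ((1 + (1 + |R|) ^ (3 / 2 : ℝ)) * (1 + ‖lam n‖) ^ (-(3 / 2) : ℝ)),
      (hW0.1.mul_left _).mul_left _, fun n z hz => (hterm n z).trans ?_⟩
    have hz' : ‖z‖ ≤ |R| := hz.trans (le_abs_self R)
    have him : |z.im| ≤ |R| := (Complex.abs_im_le_norm z).trans hz'
    have h1 : (1 + ‖z - lam n‖) ^ (-(3 / 2) : ℝ) ≤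
        (1 + |R|) ^ (3 / 2 : ℝ) * (1 + ‖lam n‖) ^ (-(3 / 2) : ℝ) := by
      have h2 : (1 + ‖lam n‖) / (1 + |R|) ≤ 1 + ‖z - lam n‖ := by
        rw [div_le_iff₀ (by positivity)]
        have := norm_sub_norm_le (lam n) z
        rw [norm_sub_rev] at this
        nlinarith [norm_nonneg (z - lam n), abs_nonneg R]
      calc (1 + ‖z - lam n‖) ^ (-(3 / 2) : ℝ) ≤ ((1 + ‖lam n‖) / (1 + |R|)) ^ (-(3 / 2) : ℝ) :=
            Real.rpow_le_rpow_of_nonpos (by positivity) h2 (by norm_num)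
        _ = _ := by
            rw [Real.div_rpow (by positivity) (by positivity), div_eq_mul_inv,
              ← Real.rpow_neg (by positivity), neg_neg, mul_comm]
    have h3 : E z ≤ M * (K * Real.exp (σ * |R|) * (1 + |R|) ^ (1 / 2 : ℝ)) := by
      simp only [hE]
      gcongr
    refine mul_le_mul h3 ?_ (by positivity) (by positivity)
    linarith

theorem differentiable_tsum_modifiedLagrangeKernel (hS : IsSineType S σ) (hσ : 0 ≤ σ)
    (hinj : Function.Injective lam) (hlam : ∀ n, S (lam n) = 0) (hc : ∃ M : ℝ, ∀ n, ‖c n‖ ≤ M) :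
    Differentiable ℂ fun z => ∑' n, c n * modifiedLagrangeKernel S (lam n) z := by
  intro z
  obtain ⟨u, hu, hbound⟩ :=
    (hS.exists_tsum_modifiedLagrangeKernel_bounds hσ hinj hlam hc).2.2 (‖z‖ + 1)
  refine (Complex.differentiableOn_tsum_of_summable_norm (U := Metric.ball 0 (‖z‖ + 1)) hu
    (fun n => ?_) Metric.isOpen_ball (fun n w hw => hbound n w ?_)).differentiableAt
    (Metric.isOpen_ball.mem_nhds (by simp))
  · exact ((hS.differentiable_modifiedLagrangeKernel (hlam n)).const_mul _).differentiableOn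
  · rw [mem_ball_zero_iff] at hw
    exact hw.le

theorem tsum_modifiedLagrangeKernel_apply_zero (hinj : Function.Injective lam)
    (hlam : ∀ n, S (lam n) = 0) (m : ℤ) :
    ∑' n, c n * modifiedLagrangeKernel S (lam n) (lam m) = c m := by
  rw [tsum_eq_single m fun n hn => by
    rw [modifiedLagrangeKernel_of_ne (hlam m) (hinj.ne hn.symm), mul_zero],
    modifiedLagrangeKernel_self (hlam m), mul_one]

end Series

end IsSineType

theorem mainTheorem4 (T : ℝ) (hT : 0 < T) (S : ℂ → ℂ) (hS : IsSineType S (T / 2))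
    (lam : ℤ → ℂ) (hinj : Function.Injective lam) (hzeros : Set.range lam = {z : ℂ | S z = 0})
    (c : ℤ → ℂ) (hc : ∃ M : ℝ, ∀ n : ℤ, ‖c n‖ ≤ M) :
    -- existence of an interpolant of exponential type `T / 2`
    (∃ g : ℂ → ℂ, Differentiable ℂ g ∧ IsOfExpType g (T / 2) ∧ ∀ n : ℤ, g (lam n) = c n) ∧
    -- the modified Lagrange series converges absolutely, and uniformly on compact sets
    (∀ z : ℂ, Summable fun n : ℤ => ‖c n * modifiedLagrangeKernel S (lam n) z‖) ∧
    (∀ K : Set ℂ, IsCompact K →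
      HasSumUniformlyOn (fun (n : ℤ) (z : ℂ) => c n * modifiedLagrangeKernel S (lam n) z)
        (fun z : ℂ => ∑' n : ℤ, c n * modifiedLagrangeKernel S (lam n) z) K) ∧
    -- every entire interpolant with the growth condition is the series plus a multiple of `S`
    (∀ g : ℂ → ℂ, Differentiable ℂ g → (∀ n : ℤ, g (lam n) = c n) →
      HasSublinearGrowth g (T / 2) →
      ∃ Cs : ℂ, ∀ z : ℂ,
        g z = (∑' n : ℤ, c n * modifiedLagrangeKernel S (lam n) z) + Cs * S z) ∧
    -- the constant is arbitrary: all these functions are such interpolants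
    (∀ (Cs : ℂ) (g : ℂ → ℂ),
      (∀ z : ℂ, g z = (∑' n : ℤ, c n * modifiedLagrangeKernel S (lam n) z) + Cs * S z) →
      Differentiable ℂ g ∧ IsOfExpType g (T / 2) ∧ (∀ n : ℤ, g (lam n) = c n) ∧
        HasSublinearGrowth g (T / 2)) := by
  have hσ : 0 ≤ T / 2 := by positivity
  have hlam : ∀ n, S (lam n) = 0 := fun n => hzeros.subset (Set.mem_range_self n)
  obtain ⟨habs, ⟨D, hD⟩, hunif⟩ :=
    hS.exists_tsum_modifiedLagrangeKernel_bounds hσ hinj hlam hc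
  obtain ⟨B, hB, hSB⟩ := hS.exists_norm_le hσ
  have hdiff := hS.differentiable_tsum_modifiedLagrangeKernel hσ hinj hlam hc
  have hfam : ∀ (Cs : ℂ) (g : ℂ → ℂ),
      (∀ z : ℂ, g z = (∑' n : ℤ, c n * modifiedLagrangeKernel S (lam n) z) + Cs * S z) →
      Differentiable ℂ g ∧ IsOfExpType g (T / 2) ∧ (∀ n : ℤ, g (lam n) = c n) ∧
        HasSublinearGrowth g (T / 2) := by
    intro Cs g hg
    have hbound : ∀ z, ‖g z‖ ≤
        (|D| + ‖Cs‖ * B) * Real.exp (T / 2 * |z.im|) * (1 + ‖z‖) ^ (1 / 2 : ℝ) := by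
      intro z
      have h1 : 1 ≤ (1 + ‖z‖) ^ (1 / 2 : ℝ) :=
        Real.one_le_rpow (by linarith [norm_nonneg z]) (by norm_num)
      have h2 : ‖Cs * S z‖ ≤
          ‖Cs‖ * B * Real.exp (T / 2 * |z.im|) * (1 + ‖z‖) ^ (1 / 2 : ℝ) := by
        refine le_trans ?_ (le_mul_of_one_le_right (by positivity) h1)
        rw [norm_mul, mul_assoc]
        exact mul_le_mul_of_nonneg_left (hSB z) (norm_nonneg _)
      have h3 : D * Real.exp (T / 2 * |z.im|) * (1 + ‖z‖) ^ (1 / 2 : ℝ) ≤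
          |D| * Real.exp (T / 2 * |z.im|) * (1 + ‖z‖) ^ (1 / 2 : ℝ) := by
        gcongr
        exact le_abs_self D
      rw [hg z]
      refine (norm_add_le _ _).trans ?_
      linarith [hD z]
    refine ⟨?_, IsOfExpType.of_norm_le_sqrt hσ (by positivity) hbound, fun n => ?_,
      HasSublinearGrowth.of_norm_le_sqrt hbound⟩
    · rw [funext hg]
      exact hdiff.add (hS.entire.const_mul Cs)
    · rw [hg, IsSineType.tsum_modifiedLagrangeKernel_apply_zero hinj hlam, hlam, mul_zero,
        add_zero]
  have hf := hfam 0 (fun z => ∑' n : ℤ, c n * modifiedLagrangeKernel S (lam n) z)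
    fun z => by rw [zero_mul, add_zero]
  refine ⟨⟨_, hf.1, hf.2.1, hf.2.2.1⟩, habs, fun K hK => ?_, fun g hg hgc hgrowth => ?_, hfam⟩
  · obtain ⟨R, hR⟩ := hK.isBounded.exists_norm_le
    obtain ⟨u, hu, hle⟩ := hunif R
    exact HasSumUniformlyOn.of_norm_le_summable hu fun n z hz => hle n z (hR z hz)
  · have hzero : ∀ z, S z = 0 →
        (g - fun z => ∑' n : ℤ, c n * modifiedLagrangeKernel S (lam n) z) z = 0 := by
      intro z hz
      obtain ⟨n, rfl⟩ := hzeros.superset hz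
      rw [Pi.sub_apply, hgc n, hf.2.2.1 n, sub_self]
    obtain ⟨C, hC⟩ :=
      hS.exists_eq_const_mul hσ (hg.sub hf.1) hzero (hgrowth.sub hf.2.2.2)
    exact ⟨C, fun z => by rw [← hC z, Pi.sub_apply, add_sub_cancel]⟩
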